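/- **Conventions.** An $mm$-space is a triple $(X,d_X,\mu_X)$, where $(X,d_X)$ is a metric space and $\mu_X$ is a Borel probability measure on it; $\mathrm{Lip}_1(X)$ is the set of all functions $f\colon X\to\mathbb R$ with $|f(x)-f(y)|\le d_X(x,y)$ for all $x,y\in X$. Let $\lambda$ be the Lebesgue measure on $[0,1]$. A *parametrization* of $X$ is a measurable map $\phi\colon[0,1]\to X$ such that $\mu_X(A)=\lambda(\phi^{-1}(A))$ for every Borel set $A\subseteq X$. For measurable $f,g\colon[0,1]\to\mathbb R$ put $$\mathrm{me}_1(f,g)=\inf\{\varepsilon>0 : \lambda\{t : |f(t)-g(t)|>\varepsilon\}<\varepsilon\}.$$ The *Gromov distance* $d_{conc}(X,Y)$ between two $mm$-spaces is the infimum of all $\varepsilon>0$ for which there are parametrizations $\phi_X$ of $X$ and $\phi_Y$ of $Y$ such that for every $f\in\mathrm{Lip}_1(X)$ there is a $g\in\mathrm{Lip}_1(Y)$ with $\mathrm{me}_1(f\circ\phi_X,g\circ\phi_Y)<\varepsilon$, and for every $g\in\mathrm{Lip}_1(Y)$ there is an $f\in\mathrm{Lip}_1(X)$ with the same property. For a totally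 bounded metric space $\Omega$ and $u>0$, the covering number $N(\Omega,u)$ is the smallest number of open balls of radius $u$ (centred at points of $\Omega$) that cover $\Omega$. For $\sigma\ge 0$, $\gamma_d(0,\sigma^2)$ is the Gaussian measure on $\mathbb R^d$ with mean $0$ and covariance matrix $\sigma^2 I$ (the Dirac measure at $0$ if $\sigma=0$). **Theorem.** Let $M$ be a compact topological manifold (Hausdorff, second countable, locally homeomorphic to $\mathbb R^m$ for a fixed $m$), and let $\mu$ be a Borel probability measure on $M$. Let $(d_n)_{n\in\mathbb N}$ be a sequence of dimensions with $d_n\to\infty$, and for every $n$ let $\iota_n\colon M\to\mathbb R^{d_n}$ be a topological embedding. Let the image $M_n=\iota_n(M)$ carry the Euclidean distance and the push-forward measure $(\iota_n)_*\mu$. Assume that the covering numbers grow as $o(d)$, that is, for every fixed $\varepsilon>0$, $$N(M_n,\varepsilon)=o(d_n)\quad\text{as } n\to\infty.$$ Let $\sigma_n\ge0$ with $\sigma_n=O(1/\sqrt{d_n})$. Then the Gromov distance between the $mm$-space $M_n$ and its corruption by Gaussian noise tends to zero: $$d_{conc}\Bigl(\bigl(M_n,\|\cdot\|_2,(\iota_n)_*\mu\bigr),\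 \bigl(\mathbb R^{d_n},\|\cdot\|_2,(\iota_n)_*\mu*\gamma_{d_n}(0,\sigma_n^2)\bigr)\Bigr)\longrightarrow 0\quad\text{as } n\to\infty.$$ -/

import Mathlib

open MeasureTheory ProbabilityTheory Filter Topology Asymptotics

/-- The metric `me₁` of convergence in measure between (measurable) functions on `[0,1]`:
`me₁(f, g) = inf {ε > 0 : λ {t : |f t - g t| > ε} < ε}`, with `λ` the Lebesgue measure.
The set contains `2` and is bounded below by `0`, so the infimum is a true one. -/
noncomputable def me1 (f g : unitInterval → ℝ) : ℝ :=
  sInf {ε : ℝ | 0 < ε ∧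
    (volume : Measure unitInterval) {t | ε < |f t - g t|} < ENNReal.ofReal ε}

/-- A parametrization of an `mm`-space `(X, μ)` by the unit interval: a measurable map
`φ : [0,1] → X` with `μ A = λ (φ ⁻¹' A)` for every Borel set `A`. -/
def IsParametrization {X : Type*} [MeasurableSpace X] (μ : Measure X)
    (φ : unitInterval → X) : Prop :=
  Measurable φ ∧ ∀ A : Set X, MeasurableSet A → μ A = volume (φ ⁻¹' A)

/-- Every feature (real-valued `1`-Lipschitz function) of `X` is matched up to `ε`, after
composition with the parametrizations `φ` and `ψ`, by a feature of `Y`. -/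
def FeaturesMatched {X Y : Type*} [MetricSpace X] [MetricSpace Y]
    (φ : unitInterval → X) (ψ : unitInterval → Y) (ε : ℝ) : Prop :=
  ∀ f : X → ℝ, LipschitzWith 1 f →
    ∃ g : Y → ℝ, LipschitzWith 1 g ∧ me1 (f ∘ φ) (g ∘ ψ) < ε

/-- Gromov's distance `d_conc` between the `mm`-spaces `(X, μ)` and `(Y, ν)`: the infimum of all
`ε > 0` for which some parametrizations of the two spaces match the features of each space
with features of the other up to `ε`. It takes values in `[0, ∞]`, and would be `∞` if there
were no parametrizations. -/
noncomputable def gromovDist {X Y : Type*} [MetricSpace X] [MeasurableSpace X]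
    [MetricSpace Y] [MeasurableSpace Y] (μ : Measure X) (ν : Measure Y) : ENNReal :=
  sInf {r : ENNReal | ∃ ε : ℝ, 0 < ε ∧ r = ENNReal.ofReal ε ∧
    ∃ (φ : unitInterval → X) (ψ : unitInterval → Y),
      IsParametrization μ φ ∧ IsParametrization ν ψ ∧
      FeaturesMatched φ ψ ε ∧ FeaturesMatched ψ φ ε}

/-- The covering number `N(Ω, u)` of a totally bounded metric space `Ω`: the smallest number of
open balls of radius `u` that cover `Ω`. -/
noncomputable def ballCoveringNumber (Ω : Type*) [MetricSpace Ω] (u : ℝ) : ℕ :=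
  sInf {n : ℕ | ∃ F : Finset Ω, F.card = n ∧ ∀ x : Ω, ∃ c ∈ F, x ∈ Metric.ball c u}

/-- The Gaussian measure `γ_d(0, σ²)` on `ℝᵈ` with mean zero and covariance matrix `σ² I`: the law
of `σ Z` for a standard Gaussian vector `Z`. -/
noncomputable def noiseGaussian (d : ℕ) (σ : ℝ) : Measure (EuclideanSpace ℝ (Fin d)) :=
  (stdGaussian (EuclideanSpace ℝ (Fin d))).map (fun z => σ • z)

/-- The measure `μ`, carried by an embedding `ι : M → E` to the image of `M`, where the image has
the metric of `E`. -/
noncomputable def imageMeasure {M E : Type*} [MeasurableSpace M] [MeasurableSpace E]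
    (ι : M → E) (μ : Measure M) : Measure (Set.range ι) :=
  μ.map (Set.rangeFactorization ι)

/-- The corruption `(ι_* μ) ∗ γ_d(0, σ²)`, a measure on the whole space `ℝᵈ`. -/
noncomputable def corruption {M : Type*} [MeasurableSpace M] {d : ℕ}
    (ι : M → EuclideanSpace ℝ (Fin d)) (μ : Measure M) (σ : ℝ) :
    Measure (EuclideanSpace ℝ (Fin d)) :=
  (μ.map ι).conv (noiseGaussian d σ)

/-! Drive both spaces by one source: a map `Φ` from the interval with law `μ ⊗ γ`, giving a point x
and an independent standard noise z. The spaces are parametrized by x and x + σz, so features need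
only be compared at coupled points, and by Fubini at each fixed x.

From M_n to the noisy space: extend a feature to G on ℝᵈ and use G ∘ P, where P projects onto the
span V of a minimal t-net. The error is at most ‖x - Px‖ + σ‖Pz‖. The first term is at most t; the
second has mean square σ² dim V ≤ σ² N(M_n, t), which tends to 0 because σ² = O(1/d) and N = o(d).

Back: replace g by its noise average x ↦ E g(x + σw). This is again 1-Lipschitz, and for fixed x the
fluctuation of g(x + σz) about it has variance at most 2σ², by a dimension-free Gaussian Poincaré
inequality (`variance_stdGaussian_le`). Chebyshev's inequality concludes in both directions
(`gromovDist_corruption_le`). -/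

/-- Absolute continuity passes to finite powers of measures. -/
theorem pi_const_absolutelyContinuous {α : Type*} [MeasurableSpace α] {μ ν : Measure α}
    [SigmaFinite μ] [SigmaFinite ν] (h : μ ≪ ν) (n : ℕ) :
    Measure.pi (fun _ : Fin n => μ) ≪ Measure.pi (fun _ : Fin n => ν) := by
  induction n with
  | zero =>
    rw [Measure.pi_of_empty, Measure.pi_of_empty]
  | succ n ih =>
    have e1 := (measurePreserving_piFinSuccAbove (fun _ : Fin (n + 1) => μ) 0).symm
    have e2 := (measurePreserving_piFinSuccAbove (fun _ : Fin (n + 1) => ν) 0).symm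
    rw [← e1.map_eq, ← e2.map_eq]
    exact (h.prod ih).map (MeasurableEquiv.measurable _)

theorem stdGaussian_absolutelyContinuous (d : ℕ) :
    stdGaussian (EuclideanSpace ℝ (Fin d)) ≪ volume := by
  rw [← map_pi_eq_stdGaussian, ← (PiLp.volume_preserving_toLp (Fin d)).map_eq]
  exact (pi_const_absolutelyContinuous (gaussianReal_absolutelyContinuous 0 one_ne_zero) d).map
    (by fun_prop)

/-! ### Lipschitz functions along a quarter circle -/

section Arc

variable {E : Type*} [NormedAddCommGroup E] [InnerProductSpace ℝ E]

/-- The values of `g` along the quarter circle from `p.1` to `p.2`. -/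
noncomputable def alongArc (g : E → ℝ) (θ : ℝ) (p : E × E) : ℝ :=
  g (Real.cos θ • p.1 + Real.sin θ • p.2)

theorem abs_alongArc_sub_le {g : E → ℝ} (hg : LipschitzWith 1 g) (θ η : ℝ) (p : E × E) :
    |alongArc g θ p - alongArc g η p| ≤ 2 * |θ - η| * ‖p‖ := by
  have h1 := hg.dist_le_mul (Real.cos θ • p.1 + Real.sin θ • p.2)
    (Real.cos η • p.1 + Real.sin η • p.2)
  rw [Real.dist_eq, dist_eq_norm, NNReal.coe_one, one_mul] at h1
  have h2 : Real.cos θ • p.1 + Real.sin θ • p.2 - (Real.cos η • p.1 + Real.sin η • p.2)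
      = (Real.cos θ - Real.cos η) • p.1 + (Real.sin θ - Real.sin η) • p.2 := by
    module
  have h3 : |Real.cos θ - Real.cos η| ≤ |θ - η| := by
    simpa [Real.dist_eq] using Real.lipschitzWith_cos.dist_le_mul θ η
  have h4 : |Real.sin θ - Real.sin η| ≤ |θ - η| := by
    simpa [Real.dist_eq] using Real.lipschitzWith_sin.dist_le_mul θ η
  rw [h2] at h1
  refine h1.trans ((norm_add_le _ _).trans ?_)
  rw [norm_smul, norm_smul, Real.norm_eq_abs, Real.norm_eq_abs]
  have := mul_le_mul h3 (norm_fst_le p) (norm_nonneg _) (abs_nonneg _)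
  have := mul_le_mul h4 (norm_snd_le p) (norm_nonneg _) (abs_nonneg _)
  linarith

theorem tendsto_mul_alongArc_sub {g : E → ℝ} {p : E × E} (hp : DifferentiableAt ℝ g p.1) (c : ℝ) :
    Tendsto (fun n : ℕ => (n : ℝ) * (alongArc g (c / n) p - alongArc g 0 p)) atTop
      (𝓝 (c * fderiv ℝ g p.1 p.2)) := by
  have h1 : HasDerivAt (fun θ : ℝ => Real.cos θ • p.1 + Real.sin θ • p.2) p.2 0 := by
    have := ((Real.hasDerivAt_cos 0).smul_const p.1).add ((Real.hasDerivAt_sin 0).smul_const p.2)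
    simpa [Pi.add_def] using this
  have h2 : HasDerivAt (fun θ => alongArc g θ p) (fderiv ℝ g p.1 p.2) 0 := by
    have h0 : HasFDerivAt g (fderiv ℝ g p.1) (Real.cos 0 • p.1 + Real.sin 0 • p.2) := by
      simpa using hp.hasFDerivAt
    exact h0.comp_hasDerivAt (0 : ℝ) h1
  have h3 : HasDerivAt (fun s : ℝ => alongArc g (c * s) p) (c * fderiv ℝ g p.1 p.2) 0 := by
    have h2' : HasDerivAt (fun θ => alongArc g θ p) (fderiv ℝ g p.1 p.2) (c * 0) := by
      simpa using h2
    have := h2'.comp (0 : ℝ) ((hasDerivAt_id (0 : ℝ)).const_mul c)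
    simpa [Function.comp_def, mul_comm] using this
  have h4 := h3.tendsto_slope
  have h5 : Tendsto (fun n : ℕ => ((n : ℝ))⁻¹) atTop (𝓝[≠] 0) := by
    refine tendsto_nhdsWithin_iff.2 ⟨tendsto_inv_atTop_nhds_zero_nat, ?_⟩
    filter_upwards [eventually_gt_atTop 0] with n hn
    simp [hn.ne']
  refine (h4.comp h5).congr fun n => ?_
  simp [slope_def_field, div_eq_mul_inv, mul_comm]

end Arc

/-! ### Rotation invariance of the Gaussian product -/

section Rotation

variable {E : Type*} [NormedAddCommGroup E] [InnerProductSpace ℝ E] [FiniteDimensional ℝ E]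
  [MeasurableSpace E] [BorelSpace E]

theorem measurable_alongArc {g : E → ℝ} (hg : LipschitzWith 1 g) (θ : ℝ) :
    Measurable (alongArc g θ) := by
  have := hg.continuous
  unfold alongArc
  exact this.measurable.comp (by fun_prop)

theorem integrable_sq_norm_stdGaussian_prod :
    Integrable (fun p : E × E => ‖p‖ ^ 2) ((stdGaussian E).prod (stdGaussian E)) := by
  have h1 : Integrable (fun x : E => ‖x‖ ^ 2) (stdGaussian E) :=
    (IsGaussian.memLp_two_id (μ := stdGaussian E)).integrable_norm_pow two_ne_zero
  refine ((h1.comp_fst (stdGaussian E)).add (h1.comp_snd (stdGaussian E))).mono'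
    (by fun_prop) (ae_of_all _ fun p => ?_)
  rw [Real.norm_of_nonneg (by positivity), Prod.norm_def]
  simp only [Pi.add_apply]
  rcases max_cases ‖p.1‖ ‖p.2‖ with h | h <;> rw [h.1] <;>
    nlinarith [sq_nonneg ‖p.1‖, sq_nonneg ‖p.2‖]

theorem integrable_sq_alongArc_sub {g : E → ℝ} (hg : LipschitzWith 1 g) (θ η : ℝ) :
    Integrable (fun p => (alongArc g θ p - alongArc g η p) ^ 2)
      ((stdGaussian E).prod (stdGaussian E)) := by
  have m1 := measurable_alongArc hg θ
  have m2 := measurable_alongArc hg η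
  refine (integrable_sq_norm_stdGaussian_prod.const_mul ((2 * |θ - η|) ^ 2)).mono'
    (by fun_prop) (ae_of_all _ fun p => ?_)
  rw [Real.norm_of_nonneg (by positivity), ← mul_pow, ← sq_abs]
  exact pow_le_pow_left₀ (abs_nonneg _) (abs_alongArc_sub_le hg θ η p) 2

/-- Rotating the pair by θ shifts the arc parameter by θ and preserves γ ⊗ γ, so increments over
arcs of equal length have the same second moment. -/
theorem integral_sq_alongArc_add_sub {g : E → ℝ} (hg : LipschitzWith 1 g) (θ h : ℝ) :
    ∫ p, (alongArc g (θ + h) p - alongArc g θ p) ^ 2 ∂((stdGaussian E).prod (stdGaussian E))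
      = ∫ p, (alongArc g h p - alongArc g 0 p) ^ 2
          ∂((stdGaussian E).prod (stdGaussian E)) := by
  have m1 := measurable_alongArc hg h
  have m2 := measurable_alongArc hg 0
  have hrot := IsGaussian.map_rotation_eq_self_of_forall_strongDual_eq_zero
    (μ := stdGaussian E) integral_strongDual_stdGaussian θ
  conv_rhs => rw [← hrot]
  rw [integral_map (by fun_prop) (by fun_prop)]
  refine integral_congr_ae (ae_of_all _ fun p => ?_)
  have e : ∀ η, alongArc g η (ContinuousLinearMap.rotation θ p) = alongArc g (θ + η) p := by
    intro η
    simp only [alongArc, ContinuousLinearMap.rotation_apply, Real.cos_add, Real.sin_add]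
    congr 1
    module
  simp only [e, add_zero]

theorem integral_sq_alongArc_nsmul_sub_le {g : E → ℝ} (hg : LipschitzWith 1 g) (n : ℕ) (h : ℝ) :
    ∫ p, (alongArc g (n * h) p - alongArc g 0 p) ^ 2 ∂((stdGaussian E).prod (stdGaussian E))
      ≤ ∫ p, (n * (alongArc g h p - alongArc g 0 p)) ^ 2
          ∂((stdGaussian E).prod (stdGaussian E)) := by
  have hi : ∀ k ∈ Finset.range n, Integrable
      (fun p => (alongArc g (k * h + h) p - alongArc g (k * h) p) ^ 2)
      ((stdGaussian E).prod (stdGaussian E)) :=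
    fun k _ => integrable_sq_alongArc_sub hg _ _
  calc _ ≤ ∫ p, n * ∑ k ∈ Finset.range n, (alongArc g (k * h + h) p - alongArc g (k * h) p) ^ 2
        ∂((stdGaussian E).prod (stdGaussian E)) := by
        refine integral_mono (integrable_sq_alongArc_sub hg _ _)
          ((integrable_finsetSum _ hi).const_mul _) fun p => ?_
        have key := Finset.sum_range_sub (fun k : ℕ => alongArc g (k * h) p) n
        simp only [Nat.cast_add, Nat.cast_one, add_mul, one_mul, Nat.cast_zero, zero_mul] at key
        simp only
        rw [← key]
        -- Cauchy–Schwarz on the telescoping sum of n increments.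
        simpa using sq_sum_le_card_mul_sum_sq (s := Finset.range n)
          (f := fun k : ℕ => alongArc g (k * h + h) p - alongArc g (k * h) p)
    _ = _ := by
        rw [integral_const_mul, integral_finsetSum _ hi]
        simp_rw [integral_sq_alongArc_add_sub hg, mul_pow]
        rw [integral_const_mul, Finset.sum_const, Finset.card_range, nsmul_eq_mul]
        ring

theorem integral_sq_dual_stdGaussian (L : StrongDual ℝ E) :
    ∫ y, (L y) ^ 2 ∂(stdGaussian E) = ‖L‖ ^ 2 := by
  have := variance_dual_stdGaussian L
  rwa [variance_of_integral_eq_zero (by fun_prop) (integral_strongDual_stdGaussian L)] at this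

end Rotation

/-! ### Gaussian Poincaré inequality -/

section Poincare

variable {d : ℕ}

local notation "γ" => stdGaussian (EuclideanSpace ℝ (Fin d))

/-- Given the first point, the derivative applied to the second is a centred Gaussian of variance
‖Dg‖² ≤ 1. -/
theorem integral_sq_fderiv_le {g : EuclideanSpace ℝ (Fin d) → ℝ} (hg : LipschitzWith 1 g) (c : ℝ)
    (hint : Integrable (fun p : EuclideanSpace ℝ (Fin d) × EuclideanSpace ℝ (Fin d) =>
      (c * fderiv ℝ g p.1 p.2) ^ 2) ((γ).prod γ)) :
    ∫ p, (c * fderiv ℝ g p.1 p.2) ^ 2 ∂((γ).prod γ) ≤ c ^ 2 := by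
  rw [integral_prod _ hint]
  simp_rw [mul_pow, integral_const_mul, integral_sq_dual_stdGaussian]
  refine mul_le_of_le_one_right (sq_nonneg c) ?_
  refine (integral_mono_of_nonneg (ae_of_all _ fun x => by positivity) (integrable_const (1 : ℝ))
    (ae_of_all _ fun x => ?_)).trans (by simp)
  exact pow_le_one₀ (norm_nonneg _) (by simpa using norm_fderiv_le_of_lipschitz ℝ hg)

/-- A dimension-free Poincaré inequality for Lipschitz functions, by the rotation argument. -/
theorem integral_prod_sq_sub_le {g : EuclideanSpace ℝ (Fin d) → ℝ} (hg : LipschitzWith 1 g) :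
    ∫ p, (g p.2 - g p.1) ^ 2 ∂((γ).prod γ) ≤ (Real.pi / 2) ^ 2 := by
  set c := Real.pi / 2 with hc
  -- Rademacher's theorem, carried from Lebesgue measure to γ by absolute continuity.
  have hdiff : ∀ᵐ p ∂((γ).prod γ), DifferentiableAt ℝ g p.1 :=
    Measure.quasiMeasurePreserving_fst.ae
      ((stdGaussian_absolutelyContinuous d).ae_le hg.ae_differentiableAt)
  have hlim : ∀ᵐ p ∂((γ).prod γ), Tendsto (fun n : ℕ =>
      ((n : ℝ) * (alongArc g (c / n) p - alongArc g 0 p)) ^ 2) atTop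
      (𝓝 ((c * fderiv ℝ g p.1 p.2) ^ 2)) := by
    filter_upwards [hdiff] with p hp
    exact (tendsto_mul_alongArc_sub hp c).pow 2
  have hbound : ∀ n : ℕ, ∀ p : EuclideanSpace ℝ (Fin d) × EuclideanSpace ℝ (Fin d),
      ‖((n : ℝ) * (alongArc g (c / n) p - alongArc g 0 p)) ^ 2‖ ≤ (2 * c) ^ 2 * ‖p‖ ^ 2 := by
    intro n p
    have hc0 : 0 ≤ c := by positivity
    rw [Real.norm_of_nonneg (by positivity), ← mul_pow, ← sq_abs]
    refine pow_le_pow_left₀ (abs_nonneg _) ?_ 2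
    rcases Nat.eq_zero_or_pos n with rfl | hn
    · simp; positivity
    have h := abs_alongArc_sub_le hg (c / n) 0 p
    rw [sub_zero, abs_of_nonneg (by positivity : 0 ≤ c / n)] at h
    rw [abs_mul, Nat.abs_cast]
    calc (n : ℝ) * _ ≤ n * (2 * (c / n) * ‖p‖) := by gcongr
      _ = 2 * c * ‖p‖ := by field_simp
  have hmeas : ∀ n : ℕ, AEStronglyMeasurable (fun p =>
      ((n : ℝ) * (alongArc g (c / n) p - alongArc g 0 p)) ^ 2) ((γ).prod γ) := by
    intro n
    have m1 := measurable_alongArc hg (c / n)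
    have m2 := measurable_alongArc hg 0
    fun_prop
  have hdom := integrable_sq_norm_stdGaussian_prod (E := EuclideanSpace ℝ (Fin d))
    |>.const_mul ((2 * c) ^ 2)
  have htend := tendsto_integral_of_dominated_convergence _ hmeas hdom
    (fun n => ae_of_all _ (hbound n)) hlim
  have hint : Integrable (fun p : EuclideanSpace ℝ (Fin d) × EuclideanSpace ℝ (Fin d) =>
      (c * fderiv ℝ g p.1 p.2) ^ 2) ((γ).prod γ) := by
    refine hdom.mono' (aestronglyMeasurable_of_tendsto_ae atTop hmeas hlim) ?_
    filter_upwards [hlim] with p hp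
    exact le_of_tendsto' hp.norm fun n => hbound n p
  -- The quarter circle is cut into n equal arcs; as n → ∞ the rescaled increment becomes the
  -- derivative.
  refine (ge_of_tendsto htend ?_).trans (integral_sq_fderiv_le hg c hint)
  filter_upwards [eventually_gt_atTop 0] with n hn
  have hn' : (n : ℝ) ≠ 0 := by positivity
  have := integral_sq_alongArc_nsmul_sub_le hg n (c / n)
  rw [mul_div_cancel₀ c hn'] at this
  simpa [alongArc, hc] using this

theorem memLp_two_stdGaussian_of_lipschitz {K : NNReal} {g : EuclideanSpace ℝ (Fin d) → ℝ}
    (hg : LipschitzWith K g) : MemLp g 2 γ := by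
  have h1 : MemLp (fun x : EuclideanSpace ℝ (Fin d) => K * ‖x‖ + |g 0|) 2 γ :=
    ((IsGaussian.memLp_two_id (μ := γ)).norm.const_mul _).add (memLp_const _)
  refine h1.mono hg.continuous.aestronglyMeasurable (ae_of_all _ fun x => ?_)
  have := hg.dist_le_mul x 0
  rw [Real.dist_eq, dist_zero_right] at this
  rw [Real.norm_eq_abs, Real.norm_of_nonneg (by positivity)]
  calc |g x| = |(g x - g 0) + g 0| := by ring_nf
    _ ≤ _ := (abs_add_le _ _).trans (by gcongr)

theorem variance_stdGaussian_le_two {g : EuclideanSpace ℝ (Fin d) → ℝ} (hg : LipschitzWith 1 g) :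
    Var[g; γ] ≤ 2 := by
  have hgm := memLp_two_stdGaussian_of_lipschitz hg
  have hi := hgm.integrable one_le_two
  have hi2 := hgm.integrable_sq
  have h := integral_prod_sq_sub_le hg
  have e : ∫ p, (g p.2 - g p.1) ^ 2 ∂((γ).prod γ) = 2 * Var[g; γ] := by
    have : ∀ p : EuclideanSpace ℝ (Fin d) × EuclideanSpace ℝ (Fin d),
        (g p.2 - g p.1) ^ 2 = (g p.2 ^ 2 + g p.1 ^ 2) - 2 * (g p.1 * g p.2) := by
      intro p; ring
    have hadd : Integrable (fun p : EuclideanSpace ℝ (Fin d) × EuclideanSpace ℝ (Fin d) =>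
        g p.2 ^ 2 + g p.1 ^ 2) ((γ).prod γ) := (hi2.comp_snd γ).add (hi2.comp_fst γ)
    simp_rw [this]
    rw [integral_sub hadd ((hi.mul_prod hi).const_mul 2),
      integral_add (hi2.comp_snd γ) (hi2.comp_fst γ), integral_const_mul, integral_prod_mul,
      integral_fun_fst (f := fun x => g x ^ 2), integral_fun_snd (f := fun x => g x ^ 2),
      variance_eq_sub hgm]
    simp only [probReal_univ, one_smul, Pi.pow_apply]
    ring
  rw [e] at h
  -- The variance is at most π²/8, which is below 2.
  nlinarith [Real.pi_lt_d2, Real.pi_pos]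

theorem variance_stdGaussian_le {K : NNReal} {g : EuclideanSpace ℝ (Fin d) → ℝ}
    (hg : LipschitzWith K g) : Var[g; γ] ≤ 2 * (K : ℝ) ^ 2 := by
  rcases eq_or_ne K 0 with rfl | hK
  · have h0 : g = fun _ => g 0 := by
      funext x
      have := hg.dist_le_mul x 0
      simpa using this
    rw [h0, variance_eq_integral aemeasurable_const]
    simp
  · have h1 : LipschitzWith 1 (fun x => (K : ℝ)⁻¹ * g x) := by
      refine LipschitzWith.of_dist_le_mul fun x y => ?_
      have hK' : (0 : ℝ) < K := NNReal.coe_pos.2 (pos_iff_ne_zero.2 hK)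
      rw [Real.dist_eq, ← mul_sub, abs_mul, abs_of_pos (inv_pos.2 hK'), ← Real.dist_eq,
        inv_mul_le_iff₀ hK']
      simpa using hg.dist_le_mul x y
    have h2 := variance_stdGaussian_le_two h1
    rw [variance_const_mul] at h2
    have hK' : (K : ℝ) ≠ 0 := by exact_mod_cast hK
    field_simp at h2
    linarith

end Poincare

/-! ### Comparing features through a coupling -/

theorem me1_lt_of_measure_lt {f g : unitInterval → ℝ} {ε ε' : ℝ} (hε : 0 < ε) (hlt : ε < ε')
    (h : (volume : Measure unitInterval) {t | ε < |f t - g t|} < ENNReal.ofReal ε) :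
    me1 f g < ε' := by
  refine lt_of_le_of_lt ?_ hlt
  exact csInf_le ⟨0, fun _ hx => hx.1.le⟩ ⟨hε, h⟩

theorem measure_comp_le_of_slice {Ω X Y : Type*} [MeasurableSpace Ω] [MeasurableSpace X]
    [MeasurableSpace Y] {P : Measure Ω} {μ : Measure X} {ν : Measure Y} [IsProbabilityMeasure μ]
    [SFinite ν] {Φ : Ω → X × Y} (hΦ : Measurable Φ) (hmap : P.map Φ = μ.prod ν)
    {D : X × Y → ℝ} (hD : Measurable D) {t : ℝ} {b : ENNReal}
    (h : ∀ x, ν {y | t < |D (x, y)|} ≤ b) :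
    P {ω | t < |D (Φ ω)|} ≤ b := by
  have hs : MeasurableSet {p | t < |D p|} := measurableSet_lt measurable_const hD.abs
  have e : {ω | t < |D (Φ ω)|} = Φ ⁻¹' {p | t < |D p|} := rfl
  rw [e, ← Measure.map_apply hΦ hs, hmap, Measure.prod_apply hs]
  calc _ ≤ ∫⁻ _, b ∂μ := lintegral_mono fun x => h x
    _ = b := by simp

/-! ### Noise estimates: projection and averaging -/

section Gaussian

variable {d : ℕ}

/-- Each coordinate in an orthonormal basis of V has second moment 1. -/
theorem integral_sq_norm_starProjection (V : Submodule ℝ (EuclideanSpace ℝ (Fin d))) :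
    Integrable (fun z => ‖V.starProjection z‖ ^ 2) (stdGaussian (EuclideanSpace ℝ (Fin d))) ∧
    ∫ z, ‖V.starProjection z‖ ^ 2 ∂(stdGaussian (EuclideanSpace ℝ (Fin d)))
      = Module.finrank ℝ V := by
  set b := stdOrthonormalBasis ℝ V
  have e : ∀ z, ‖V.starProjection z‖ ^ 2 = ∑ i, (innerSL ℝ (b i : EuclideanSpace ℝ (Fin d)) z) ^ 2 := by
    intro z
    rw [Submodule.starProjection_apply, ← Submodule.coe_norm, ← b.sum_sq_inner_right]
    refine Finset.sum_congr rfl fun i _ => ?_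
    rw [innerSL_apply_apply, Submodule.inner_orthogonalProjectionOnto_eq_of_mem_left]
  have hi : ∀ i ∈ Finset.univ, Integrable
      (fun z => (innerSL ℝ (b i : EuclideanSpace ℝ (Fin d)) z) ^ 2)
      (stdGaussian (EuclideanSpace ℝ (Fin d))) := fun i _ =>
    (memLp_two_stdGaussian_of_lipschitz
      (innerSL ℝ (b i : EuclideanSpace ℝ (Fin d))).lipschitz).integrable_sq
  simp_rw [e]
  refine ⟨integrable_finsetSum _ hi, ?_⟩
  rw [integral_finsetSum _ hi]
  simp_rw [integral_sq_dual_stdGaussian, innerSL_apply_norm]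
  have : ∀ i, ‖(b i : EuclideanSpace ℝ (Fin d))‖ = 1 := fun i => b.orthonormal.1 i
  simp [this]

theorem measure_le_mul_norm_starProjection (V : Submodule ℝ (EuclideanSpace ℝ (Fin d)))
    (σ : ℝ) {t : ℝ} (ht : 0 < t) :
    stdGaussian (EuclideanSpace ℝ (Fin d)) {z | t ≤ σ * ‖V.starProjection z‖}
      ≤ ENNReal.ofReal (σ ^ 2 * Module.finrank ℝ V / t ^ 2) := by
  obtain ⟨hi, he⟩ := integral_sq_norm_starProjection V
  have h := mul_meas_ge_le_integral_of_nonneg (μ := stdGaussian (EuclideanSpace ℝ (Fin d)))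
    (f := fun z => σ ^ 2 * ‖V.starProjection z‖ ^ 2) (ae_of_all _ fun z => by positivity)
    (hi.const_mul _) (t ^ 2)
  rw [integral_const_mul, he, ← le_div_iff₀' (by positivity)] at h
  refine (measure_mono fun z hz => ?_).trans
    ((ENNReal.le_ofReal_iff_toReal_le (measure_ne_top _ _) (by positivity)).2 h)
  have := pow_le_pow_left₀ ht.le hz 2
  rwa [mul_pow] at this

theorem measure_abs_sub_integral_gt_le {g : EuclideanSpace ℝ (Fin d) → ℝ} (hg : LipschitzWith 1 g)
    (x : EuclideanSpace ℝ (Fin d)) {σ : ℝ} (hσ : 0 ≤ σ) {t : ℝ} (ht : 0 < t) :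
    stdGaussian (EuclideanSpace ℝ (Fin d)) {z | t ≤ |g (x + σ • z)
        - ∫ w, g (x + σ • w) ∂(stdGaussian (EuclideanSpace ℝ (Fin d)))|}
      ≤ ENNReal.ofReal (2 * σ ^ 2 / t ^ 2) := by
  have hL : LipschitzWith ⟨σ, hσ⟩ (fun z => g (x + σ • z)) := by
    refine LipschitzWith.of_dist_le_mul fun y z => ?_
    refine (hg.dist_le_mul _ _).trans ?_
    rw [dist_add_left, dist_smul₀]
    rw [Real.norm_of_nonneg hσ, NNReal.coe_one, one_mul]
    exact le_rfl
  refine (meas_ge_le_variance_div_sq (memLp_two_stdGaussian_of_lipschitz hL) ht).trans ?_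
  have := variance_stdGaussian_le hL
  gcongr
  exact this

theorem lipschitzWith_integral_add_smul {g : EuclideanSpace ℝ (Fin d) → ℝ} (hg : LipschitzWith 1 g)
    (σ : ℝ) : LipschitzWith 1
      (fun x => ∫ w, g (x + σ • w) ∂(stdGaussian (EuclideanSpace ℝ (Fin d)))) := by
  have hi : ∀ x, Integrable (fun w => g (x + σ • w)) (stdGaussian (EuclideanSpace ℝ (Fin d))) := by
    intro x
    have hL : LipschitzWith ‖σ‖₊ (fun z => g (x + σ • z)) := by
      refine LipschitzWith.of_dist_le_mul fun y z => ?_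
      refine (hg.dist_le_mul _ _).trans ?_
      rw [dist_add_left, dist_smul₀]
      simp
    exact (memLp_two_stdGaussian_of_lipschitz hL).integrable one_le_two
  refine LipschitzWith.of_dist_le_mul fun x y => ?_
  rw [dist_eq_norm, ← integral_sub (hi x) (hi y)]
  refine (norm_integral_le_of_norm_le_const (C := dist x y) (ae_of_all _ fun w => ?_)).trans
    (by simp)
  rw [← dist_eq_norm]
  simpa using hg.dist_le_mul (x + σ • w) (y + σ • w)

end Gaussian

theorem exists_lipschitz_extension_range {M E : Type*} [MetricSpace E] {ι : M → E}
    {f : Set.range ι → ℝ} (hf : LipschitzWith 1 f) :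
    ∃ F : E → ℝ, LipschitzWith 1 F ∧ ∀ x, F (ι x) = f (Set.rangeFactorization ι x) := by
  classical
  have h : LipschitzOnWith 1 (fun y => if hy : y ∈ Set.range ι then f ⟨y, hy⟩ else 0)
      (Set.range ι) := by
    refine LipschitzOnWith.of_dist_le_mul fun x hx y hy => ?_
    simp only [hx, hy, dif_pos]
    exact hf.dist_le_mul _ _
  obtain ⟨F, hF, he⟩ := h.extend_real
  refine ⟨F, hF, fun x => ?_⟩
  rw [← he (Set.mem_range_self x)]
  simp [Set.rangeFactorization]

/-! ### The coupled parametrizations and feature matching -/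

section Corruption

variable {M : Type*} [TopologicalSpace M] [MeasurableSpace M] [BorelSpace M] {d : ℕ}

theorem isParametrization_imageMeasure {μ : Measure M} [IsProbabilityMeasure μ]
    {ι : M → EuclideanSpace ℝ (Fin d)} (hι : Continuous ι)
    {Φ : unitInterval → M × EuclideanSpace ℝ (Fin d)} (hΦ : Measurable Φ)
    (hmap : volume.map Φ = μ.prod (stdGaussian (EuclideanSpace ℝ (Fin d)))) :
    IsParametrization (imageMeasure ι μ) (fun s => Set.rangeFactorization ι (Φ s).1) := by
  have hr : Measurable (Set.rangeFactorization ι) := hι.measurable.subtype_mk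
  have hm : Measurable fun s => Set.rangeFactorization ι (Φ s).1 := hr.comp hΦ.fst
  refine ⟨hm, fun A hA => ?_⟩
  rw [← Measure.map_apply hm hA, imageMeasure]
  congr 1
  have h1 : (μ.prod (stdGaussian (EuclideanSpace ℝ (Fin d)))).map Prod.fst = μ := by
    rw [Measure.map_fst_prod]; simp
  conv_lhs => rw [← h1, ← hmap]
  rw [Measure.map_map measurable_fst hΦ, Measure.map_map hr (measurable_fst.comp hΦ)]
  rfl

theorem isParametrization_corruption {μ : Measure M} [IsProbabilityMeasure μ]
    {ι : M → EuclideanSpace ℝ (Fin d)} (hι : Continuous ι) (σ : ℝ)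
    {Φ : unitInterval → M × EuclideanSpace ℝ (Fin d)} (hΦ : Measurable Φ)
    (hmap : volume.map Φ = μ.prod (stdGaussian (EuclideanSpace ℝ (Fin d)))) :
    IsParametrization (corruption ι μ σ) (fun s => ι (Φ s).1 + σ • (Φ s).2) := by
  have hr := hι.measurable
  have hs : Measurable (fun z : EuclideanSpace ℝ (Fin d) => σ • z) := measurable_const_smul σ
  have hm : Measurable fun s => ι (Φ s).1 + σ • (Φ s).2 :=
    (hr.comp hΦ.fst).add (hs.comp hΦ.snd)
  refine ⟨hm, fun A hA => ?_⟩
  rw [← Measure.map_apply hm hA, corruption, noiseGaussian, Measure.conv,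
    Measure.map_prod_map _ _ hr hs, ← hmap, Measure.map_map (hr.prodMap hs) hΦ,
    Measure.map_map (by fun_prop) ((hr.prodMap hs).comp hΦ)]
  rfl

theorem featuresMatched_corruption {μ : Measure M} [IsProbabilityMeasure μ]
    {ι : M → EuclideanSpace ℝ (Fin d)} (hι : Continuous ι) {σ : ℝ} (hσ : 0 ≤ σ)
    {Φ : unitInterval → M × EuclideanSpace ℝ (Fin d)} (hΦ : Measurable Φ)
    (hmap : volume.map Φ = μ.prod (stdGaussian (EuclideanSpace ℝ (Fin d)))) {t : ℝ} (ht : 0 < t)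
    (F : Finset (Set.range ι)) (hF : ∀ x : Set.range ι, ∃ c ∈ F, x ∈ Metric.ball c t)
    (hsmall : σ ^ 2 * F.card < t ^ 3) :
    FeaturesMatched (fun s => Set.rangeFactorization ι (Φ s).1)
      (fun s => ι (Φ s).1 + σ • (Φ s).2) (3 * t) := by
  classical
  intro f hf
  obtain ⟨G, hG, hGf⟩ := exists_lipschitz_extension_range hf
  set V : Submodule ℝ (EuclideanSpace ℝ (Fin d)) :=
    Submodule.span ℝ ((F.image Subtype.val : Finset _) : Set (EuclideanSpace ℝ (Fin d))) with hV
  have hdim : Module.finrank ℝ V ≤ F.card :=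
    (finrank_span_finset_le_card _).trans Finset.card_image_le
  have hclose : ∀ x, ‖ι x - V.starProjection (ι x)‖ ≤ t := by
    intro x
    obtain ⟨c, hc, hxc⟩ := hF ⟨ι x, Set.mem_range_self x⟩
    have hcV : (c : EuclideanSpace ℝ (Fin d)) ∈ V :=
      Submodule.subset_span (Finset.mem_coe.2 (Finset.mem_image_of_mem _ hc))
    -- The projection is the nearest point of V, so it is no farther than the net centre c.
    rw [Submodule.starProjection_minimal]
    refine (ciInf_le ⟨0, ?_⟩ (⟨c, hcV⟩ : V)).trans ?_
    · rintro _ ⟨y, rfl⟩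
      exact norm_nonneg _
    · rw [← dist_eq_norm]
      exact (Metric.mem_ball.1 hxc).le
  have hPL : LipschitzWith 1 V.starProjection := by
    refine LipschitzWith.of_dist_le_mul fun x y => ?_
    rw [dist_eq_norm, dist_eq_norm, ← map_sub, NNReal.coe_one, one_mul]
    exact Submodule.norm_starProjection_apply_le _ _
  have hGP : LipschitzWith 1 (fun y => G (V.starProjection y)) := by
    simpa [Function.comp_def] using hG.comp hPL
  -- The threshold 2t allows t for the net and t for the projected noise.
  refine ⟨_, hGP, me1_lt_of_measure_lt (ε := 2 * t) (by linarith) (by linarith) ?_⟩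
  refine (measure_comp_le_of_slice hΦ hmap
    (D := fun p => f (Set.rangeFactorization ι p.1) - G (V.starProjection (ι p.1 + σ • p.2)))
    (b := ENNReal.ofReal (σ ^ 2 * Module.finrank ℝ V / t ^ 2)) ?_ fun x => ?_).trans_lt ?_
  · simp_rw [← hGf]
    have := hι.measurable
    have := hG.continuous.measurable
    have := hGP.continuous.measurable
    fun_prop
  · refine (measure_mono fun z hz => ?_).trans (measure_le_mul_norm_starProjection V σ ht)
    simp only [Set.mem_ofPred_eq] at hz ⊢
    rw [← hGf] at hz
    have h1 := hG.dist_le_mul (ι x) (V.starProjection (ι x + σ • z))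
    rw [Real.dist_eq, dist_eq_norm, NNReal.coe_one, one_mul, map_add, map_smul,
      ← sub_sub] at h1
    have h2 := norm_sub_le (ι x - V.starProjection (ι x)) (σ • V.starProjection z)
    rw [norm_smul, Real.norm_of_nonneg hσ] at h2
    rw [map_add, map_smul] at hz
    linarith [hclose x]
  · refine (ENNReal.ofReal_lt_ofReal_iff (by linarith)).2 ?_
    rw [div_lt_iff₀ (by positivity)]
    have : σ ^ 2 * (Module.finrank ℝ V : ℝ) ≤ σ ^ 2 * F.card := by gcongr
    nlinarith [pow_pos ht 3]

theorem featuresMatched_of_corruption {μ : Measure M} [IsProbabilityMeasure μ]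
    {ι : M → EuclideanSpace ℝ (Fin d)} (hι : Continuous ι) {σ : ℝ} (hσ : 0 ≤ σ)
    {Φ : unitInterval → M × EuclideanSpace ℝ (Fin d)} (hΦ : Measurable Φ)
    (hmap : volume.map Φ = μ.prod (stdGaussian (EuclideanSpace ℝ (Fin d)))) {t : ℝ} (ht : 0 < t)
    (hsmall : σ ^ 2 * 2 < t ^ 3) :
    FeaturesMatched (fun s => ι (Φ s).1 + σ • (Φ s).2)
      (fun s => Set.rangeFactorization ι (Φ s).1) (3 * t) := by
  intro g hg
  have hL := lipschitzWith_integral_add_smul hg σ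
  refine ⟨fun x => ∫ w, g (x + σ • w) ∂(stdGaussian (EuclideanSpace ℝ (Fin d))),
    LipschitzWith.of_dist_le_mul fun x y => hL.dist_le_mul x y,
    me1_lt_of_measure_lt (ε := t) ht (by linarith) ?_⟩
  refine (measure_comp_le_of_slice hΦ hmap
    (D := fun p => g (ι p.1 + σ • p.2)
      - ∫ w, g (ι p.1 + σ • w) ∂(stdGaussian (EuclideanSpace ℝ (Fin d))))
    (b := ENNReal.ofReal (2 * σ ^ 2 / t ^ 2)) ?_ fun x => ?_).trans_lt ?_
  · have h0 := hι.measurable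
    have h1 := hg.continuous.measurable
    exact (h1.comp (by fun_prop)).sub (hL.continuous.measurable.comp (by fun_prop))
  · exact le_trans (measure_mono fun z (hz : t < _) => hz.le)
      (measure_abs_sub_integral_gt_le hg (ι x) hσ ht)
  · refine (ENNReal.ofReal_lt_ofReal_iff ht).2 ?_
    rw [div_lt_iff₀ (by positivity)]
    nlinarith

variable [T2Space M] [SecondCountableTopology M] [CompactSpace M]

/-- In t³ = t² · t, the factor t² is Chebyshev's denominator and t the permitted measure. The
summand 2 serves the variance bound. -/
theorem gromovDist_corruption_le {μ : Measure M} [IsProbabilityMeasure μ]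
    {ι : M → EuclideanSpace ℝ (Fin d)} (hι : Continuous ι) {σ : ℝ} (hσ : 0 ≤ σ) {t : ℝ}
    (ht : 0 < t) (hsmall : σ ^ 2 * (ballCoveringNumber (Set.range ι) t + 2) < t ^ 3) :
    gromovDist (imageMeasure ι μ) (corruption ι μ σ) ≤ ENNReal.ofReal (3 * t) := by
  have hne : Nonempty M := μ.nonempty_of_neZero
  have : CompactSpace (Set.range ι) := isCompact_iff_compactSpace.1 (isCompact_range hι)
  -- Without a finite cover the natural-number infimum would default to 0; compactness makes it
  -- attained.
  have hcover : {n : ℕ | ∃ F : Finset (Set.range ι), F.card = n ∧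
      ∀ x : Set.range ι, ∃ c ∈ F, x ∈ Metric.ball c t}.Nonempty := by
    obtain ⟨s, -, hs, hsc⟩ := finite_cover_balls_of_compact
      (isCompact_univ (X := Set.range ι)) ht
    refine ⟨_, hs.toFinset, rfl, fun x => ?_⟩
    obtain ⟨c, hc, hxc⟩ := Set.mem_iUnion₂.1 (hsc (Set.mem_univ x))
    exact ⟨c, hs.mem_toFinset.2 hc, hxc⟩
  obtain ⟨F, hFcard, hF⟩ := Nat.sInf_mem hcover
  change F.card = ballCoveringNumber (Set.range ι) t at hFcard
  rw [← hFcard] at hsmall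
  have : PolishSpace M := by
    let _ := TopologicalSpace.metrizableSpaceMetric M
    infer_instance
  obtain ⟨Φ, hΦ, hmap⟩ := Measure.exists_measurable_map_eq
    (μ.prod (stdGaussian (EuclideanSpace ℝ (Fin d))))
  have hσ2 := sq_nonneg σ
  refine sInf_le ⟨3 * t, by linarith, rfl, _, _, isParametrization_imageMeasure hι hΦ hmap,
    isParametrization_corruption hι σ hΦ hmap,
    featuresMatched_corruption hι hσ hΦ hmap ht F hF ?_,
    featuresMatched_of_corruption hι hσ hΦ hmap ht ?_⟩
  · linarith
  · have : 0 ≤ σ ^ 2 * (F.card : ℝ) := by positivity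
    linarith

end Corruption

/-! ### Asymptotics and conclusion -/

theorem eventually_sq_mul_lt {d : ℕ → ℕ} (hd : Tendsto d atTop atTop) {σ N : ℕ → ℝ}
    (hN : ∀ n, 0 ≤ N n) (hNd : N =o[atTop] fun n => (d n : ℝ))
    (hσ : σ =O[atTop] fun n => 1 / √(d n : ℝ)) {η : ℝ} (hη : 0 < η) :
    ∀ᶠ n in atTop, σ n ^ 2 * (N n + 2) < η := by
  obtain ⟨C, hC, hσC⟩ := hσ.exists_pos
  -- Eventually N and 2 are each at most δd with δ = η/(4C²), and σ² ≤ C²/d, so the product is at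
  -- most η/2.
  have hδ : 0 < η / (4 * C ^ 2) := by positivity
  filter_upwards [hσC.bound, hNd.bound hδ,
    (tendsto_natCast_atTop_atTop.comp hd).eventually_ge_atTop (2 / (η / (4 * C ^ 2))),
    hd.eventually_gt_atTop 0] with n h1 h2 h3 h4
  have hd0 : (0 : ℝ) < d n := by exact_mod_cast h4
  rw [Real.norm_of_nonneg (hN n), Real.norm_of_nonneg hd0.le] at h2
  rw [Function.comp_apply, div_le_iff₀ hδ] at h3
  have h5 : σ n ^ 2 ≤ C ^ 2 / d n := by
    have := pow_le_pow_left₀ (norm_nonneg _) h1 2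
    rw [Real.norm_eq_abs, sq_abs, mul_pow, Real.norm_of_nonneg (by positivity), div_pow,
      Real.sq_sqrt hd0.le] at this
    simpa [div_eq_mul_inv] using this
  calc σ n ^ 2 * (N n + 2)
      ≤ C ^ 2 / d n * (η / (4 * C ^ 2) * d n + d n * (η / (4 * C ^ 2))) := by
        have := hN n
        gcongr
    _ = η / 2 := by field_simp; ring
    _ < η := by linarith

theorem mainTheorem3
    {m : ℕ} {M : Type*} [TopologicalSpace M] [T2Space M] [SecondCountableTopology M]
    [ChartedSpace (EuclideanSpace ℝ (Fin m)) M] [CompactSpace M]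
    [MeasurableSpace M] [BorelSpace M]
    (μ : Measure M) [IsProbabilityMeasure μ]
    (d : ℕ → ℕ) (hd : Tendsto d atTop atTop)
    (ι : ∀ n : ℕ, M → EuclideanSpace ℝ (Fin (d n))) (hι : ∀ n : ℕ, IsEmbedding (ι n))
    (hcov : ∀ ε : ℝ, 0 < ε →
      (fun n : ℕ => (ballCoveringNumber (Set.range (ι n)) ε : ℝ)) =o[atTop]
        (fun n : ℕ => (d n : ℝ)))
    (σ : ℕ → ℝ) (hσ_nonneg : ∀ n : ℕ, 0 ≤ σ n)
    (hσ : σ =O[atTop] (fun n : ℕ => 1 / √(d n : ℝ))) :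
    Tendsto (fun n : ℕ => gromovDist (imageMeasure (ι n) μ) (corruption (ι n) μ (σ n)))
      atTop (𝓝 0) := by
  rw [ENNReal.tendsto_nhds_zero]
  intro ε hε
  obtain ⟨r, hr0, hrε⟩ := ENNReal.lt_iff_exists_real_btwn.1 hε
  have hr : 0 < r := by simpa using hrε.1
  have ht : 0 < r / 3 := by positivity
  filter_upwards [eventually_sq_mul_lt hd (fun n => Nat.cast_nonneg _) (hcov _ ht) hσ
    (pow_pos ht 3)] with n hn
  refine (gromovDist_corruption_le (hι n).continuous (hσ_nonneg n) ht hn).trans ?_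
  rw [mul_div_cancel₀ r three_ne_zero]
  exact hrε.2.le
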